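/- A $k$-level tree is a tree $(V,E)$ together with a leveling $\phi:V\to\{1,\dots,k\}$ such that $\phi(u)\ne\phi(v)$ for every edge $uv$. Let $l_1,\dots,l_k$ be $k$ pairwise disjoint straight lines in the plane and let $r_1,\dots,r_{k+1}$ be the regions into which they divide the plane (the connected components of the complement of their union), numbered so that, for all $1\le i<h\le k+1$, every straight-line segment connecting a point of $r_i$ with a point of $r_h$ cuts all and only the lines $l_i,l_{i+1},\dots,l_{h-1}$, in this order. A (straight-line) region-level drawing of a $k$-level tree with respect to these regions places distinct vertices at distinct points, each vertex $v$ inside $r_{\phi(v)}$, and draws each edge as the straight-line segment between its end-vertices; it is planar if no two edges intersect except, possibly, at common end-points. A $k$-level tree is region-level nonplanar if, for every choice of such lines and regions, it admits no planar region-level drawing. Let $T$ be the $4$-level tree with vertices $v_1,\dots,v_{10}$, edges $v_1v_2,\ v_1v_3,\ v_1v_4,\ v_2v_5,\ v_2v_8,\ v_3v_6,\ v_3v_9,\ v_4v_7,\ v_4v_{10}$, and levels $\phi(v_5)=\phi(v_6)=\phi(v_7)=1$, $\phi(v_1)=2$, $\phi(v_2)=\phi(v_3)=\phi(v_4)=3$,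 $\phi(v_8)=\phi(v_9)=\phi(v_{10})=4$. Then $T$ is region-level nonplanar. -/

import Mathlib

/-- The Euclidean plane. -/
abbrev Plane : Type := EuclideanSpace ℝ (Fin 2)

/-- A `k`-level tree on the vertex set `V`: a tree together with a leveling of its vertices such
that adjacent vertices have different levels.  The levels `1, …, k` are indexed by `Fin k`, so
level `i + 1` is the element `i`. -/
structure LevelTree (k : ℕ) (V : Type*) where
  /-- the underlying tree -/
  graph : SimpleGraph V
  isTree : graph.IsTree
  /-- the leveling -/
  level : V → Fin k
  level_ne : ∀ ⦃u v : V⦄, graph.Adj u v → level u ≠ level v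

/-- `l 0, …, l (k - 1)` are `k` pairwise non-crossing straight lines in the plane, and
`r 0, …, r k` are the `k + 1` regions into which they divide the plane (the connected components of
the complement of the union of the lines), numbered in such a way that every segment from a point
of `r i` to a point of `r h`, where `i < h`, cuts all and only the lines `l i, …, l (h - 1)`, in
this order. -/
structure IsRegionSystem {k : ℕ} (l : Fin k → AffineSubspace ℝ Plane)
    (r : Fin (k + 1) → Set Plane) : Prop where
  isLine : ∀ j, Module.finrank ℝ (l j).direction = 1
  nonCrossing : ∀ j j', j ≠ j' → Disjoint (l j : Set Plane) (l j' : Set Plane)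
  injective : Function.Injective r
  range_eq : Set.range r =
    {C | ∃ x ∈ (⋃ j, (l j : Set Plane))ᶜ, C = connectedComponentIn (⋃ j, (l j : Set Plane))ᶜ x}
  cuts_iff : ∀ i h : Fin (k + 1), i < h → ∀ p ∈ r i, ∀ q ∈ r h, ∀ j : Fin k,
    (segment ℝ p q ∩ (l j : Set Plane)).Nonempty ↔ i ≤ j.castSucc ∧ j.castSucc < h
  cuts_in_order : ∀ i h : Fin (k + 1), i < h → ∀ p ∈ r i, ∀ q ∈ r h, ∀ j j' : Fin k, j < j' →
    ∀ t ∈ Set.Icc (0 : ℝ) 1, ∀ t' ∈ Set.Icc (0 : ℝ) 1,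
      AffineMap.lineMap p q t ∈ l j → AffineMap.lineMap p q t' ∈ l j' → t < t'

namespace LevelTree

variable {k : ℕ} {V : Type*}

/-- A (straight-line) region-level drawing of `T` with respect to the regions `r 0, …, r k`:
distinct vertices are placed at distinct points, and every vertex of level `i` lies in the region `r i`. The
edge `uv` is drawn as the segment from `pos u` to `pos v`. -/
def IsRegionLevelDrawing (T : LevelTree k V) (r : Fin (k + 1) → Set Plane) (pos : V → Plane) :
    Prop :=
  Function.Injective pos ∧ ∀ v, pos v ∈ r (T.level v).castSucc

/-- The straight-line drawing given by `pos` is planar: no two distinct edges intersect, except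
possibly at common end-points. -/
def IsPlanarDrawing (T : LevelTree k V) (pos : V → Plane) : Prop :=
  ∀ a b c d : V, T.graph.Adj a b → T.graph.Adj c d → s(a, b) ≠ s(c, d) →
    segment ℝ (pos a) (pos b) ∩ segment ℝ (pos c) (pos d) ⊆
      pos '' (({a, b} : Set V) ∩ {c, d})

/-- `T` is region-level nonplanar if it admits no planar region-level drawing, whatever the lines
and the regions are. -/
def IsRegionLevelNonplanar (T : LevelTree k V) : Prop :=
  ¬ ∃ (l : Fin k → AffineSubspace ℝ Plane) (r : Fin (k + 1) → Set Plane) (pos : V → Plane),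
    IsRegionSystem l r ∧ T.IsRegionLevelDrawing r pos ∧ T.IsPlanarDrawing pos

end LevelTree

/-- The tree on `v₁, …, v₁₀` (the vertex `vᵢ` is the element `i - 1` of `Fin 10`) in which `v₁` is
adjacent to `v₂, v₃, v₄`, and `v₂`, `v₃`, `v₄` are adjacent to the leaves `v₅, v₈`, to the leaves
`v₆, v₉` and to the leaves `v₇, v₁₀`, respectively. -/
def underlyingTree : SimpleGraph (Fin 10) where
  Adj u v :=
    s(u, v) ∈ ({s(0, 1), s(0, 2), s(0, 3), s(1, 4), s(1, 7), s(2, 5), s(2, 8), s(3, 6), s(3, 9)} :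
      Finset (Sym2 (Fin 10)))
  symm := ⟨fun u v h => by rwa [Sym2.eq_swap (a := v) (b := u)]⟩
  loopless := ⟨by decide⟩

instance : DecidableRel underlyingTree.Adj := fun u v => by
  unfold underlyingTree
  infer_instance

theorem underlyingTree_isTree : underlyingTree.IsTree := by
  rw [SimpleGraph.isTree_iff_connected_and_card]
  refine ⟨?_, ?_⟩
  · have h : ∀ v : Fin 10, underlyingTree.Reachable 0 v := by
      have e : ∀ {u v : Fin 10}, underlyingTree.Adj u v → underlyingTree.Reachable u v :=
        fun h => h.reachable
      have h1 := e (u := 0) (v := 1) (by decide)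
      have h2 := e (u := 0) (v := 2) (by decide)
      have h3 := e (u := 0) (v := 3) (by decide)
      intro v
      fin_cases v
      · exact SimpleGraph.Reachable.refl _
      · exact h1
      · exact h2
      · exact h3
      · exact h1.trans (e (by decide))
      · exact h2.trans (e (by decide))
      · exact h3.trans (e (by decide))
      · exact h1.trans (e (by decide))
      · exact h2.trans (e (by decide))
      · exact h3.trans (e (by decide))
    exact (SimpleGraph.connected_iff _).2 ⟨fun u v => (h u).symm.trans (h v), inferInstance⟩
  · rw [Nat.card_eq_fintype_card, Nat.card_eq_fintype_card, ← SimpleGraph.edgeFinset_card,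
      Fintype.card_fin]
    decide

/-- The `4`-level tree on `underlyingTree` with `v₅, v₆, v₇` on level `1`, with `v₁` on level `2`,
with `v₂, v₃, v₄` on level `3` and with `v₈, v₉, v₁₀` on level `4`. -/
def fourLevelTree : LevelTree 4 (Fin 10) where
  graph := underlyingTree
  isTree := underlyingTree_isTree
  level := ![1, 2, 2, 2, 0, 0, 0, 3, 3, 3]
  level_ne := by decide

/-! Disjoint lines are parallel, so the dividing lines are level sets of one linear functional `f`
(the height), and the regions are met in order of height, up to a global reversal. Let `g` be a
second coordinate. Each path from a level-1 leaf through `v₂`, `v₃` or `v₄` to a level-4 leaf is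
monotone in height, and the three paths are disjoint. Let `O` be the position of `v₁`, and `B i` the
middle point of path `i`. Between the heights of `O` and `B i`, another path `j` meets neither path
`i` nor the edge from `O` to `B i`, and these two end together at `B i`. So at the height of `O`,
path `j` lies on the same side of `O` as of path `i`. The middle one of the three paths at that
height would then lie on both sides of `O`. The core is `not_disjoint_monotone_paths`;
`IsRegionSystem.between` supplies the heights. -/

open Set

/-! ### Linear coordinates adapted to parallel lines. -/

/-- Every line through the origin of the plane is the kernel of a functional which belongs to a
system of linear coordinates. -/
theorem exists_coordinates_of_finrank_eq_one (D : Submodule ℝ Plane)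
    (hD : Module.finrank ℝ D = 1) :
    ∃ f g : Plane →L[ℝ] ℝ, (∀ x y, f x = f y → g x = g y → x = y) ∧ ∀ x, x ∈ D ↔ f x = 0 := by
  obtain ⟨⟨u, huD⟩, hu0, hu⟩ := finrank_eq_one_iff'.1 hD
  have hu0' : u ≠ 0 := fun h => hu0 (by simpa using h)
  have hpos : 0 < u 0 ^ 2 + u 1 ^ 2 := by
    by_contra hneg
    refine hu0' ?_
    ext i
    have h0 : u 0 = 0 := by nlinarith [sq_nonneg (u 0), sq_nonneg (u 1)]
    have h1 : u 1 = 0 := by nlinarith [sq_nonneg (u 0), sq_nonneg (u 1)]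
    fin_cases i <;> simp [h0, h1]
  let π : Fin 2 → Plane →L[ℝ] ℝ := fun i => EuclideanSpace.proj i
  have hπ : ∀ i x, π i x = x i := fun _ _ => rfl
  have key : ∀ x : Plane, u 1 * x 0 - u 0 * x 1 = 0 →
      x = ((u 0 * x 0 + u 1 * x 1) / (u 0 ^ 2 + u 1 ^ 2)) • u := by
    intro x hx
    ext i
    fin_cases i
    · simp only [Fin.zero_eta, PiLp.smul_apply, smul_eq_mul]
      rw [div_mul_eq_mul_div, eq_div_iff hpos.ne']
      linear_combination u 1 * hx
    · simp only [Fin.mk_one, PiLp.smul_apply, smul_eq_mul]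
      rw [div_mul_eq_mul_div, eq_div_iff hpos.ne']
      linear_combination -u 0 * hx
  -- For a direction vector `u`, these are the pairings with `u` turned by a right angle and with
  -- `u` itself.
  refine ⟨u 1 • π 0 - u 0 • π 1, u 0 • π 0 + u 1 • π 1, ?_, ?_⟩
  · intro x y hf hg
    simp only [sub_apply, add_apply,
      smul_apply, smul_eq_mul, hπ] at hf hg
    have h := key (x - y) (by simp only [PiLp.sub_apply]; linarith)
    have h' : u 0 * (x - y) 0 + u 1 * (x - y) 1 = 0 := by
      simp only [PiLp.sub_apply]; linarith
    rw [h', zero_div, zero_smul] at h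
    exact sub_eq_zero.1 h
  · intro x
    simp only [sub_apply, smul_apply, smul_eq_mul, hπ]
    constructor
    · intro hx
      obtain ⟨c, hc⟩ := hu ⟨x, hx⟩
      have hc' : c • u = x := congrArg Subtype.val hc
      rw [← hc']
      simp only [PiLp.smul_apply, smul_eq_mul]
      ring
    · intro hx
      rw [key x hx]
      exact D.smul_mem _ huD

/-- Disjoint lines in the plane are parallel. -/
theorem direction_eq_of_disjoint_lines {l l' : AffineSubspace ℝ Plane}
    (hl : Module.finrank ℝ l.direction = 1) (hl' : Module.finrank ℝ l'.direction = 1)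
    (h : Disjoint (l : Set Plane) (l' : Set Plane)) : l.direction = l'.direction := by
  have hne : ∀ m : AffineSubspace ℝ Plane, Module.finrank ℝ m.direction = 1 →
      (m : Set Plane).Nonempty := by
    intro m hm
    rw [AffineSubspace.nonempty_iff_ne_bot]
    rintro rfl
    rw [AffineSubspace.direction_bot, finrank_bot] at hm
    exact zero_ne_one hm
  by_contra hdir
  have hlt : l.direction < l.direction ⊔ l'.direction := by
    refine lt_of_le_of_ne le_sup_left fun heq => hdir ?_
    have hle : l'.direction ≤ l.direction := heq ▸ le_sup_right
    exact (Submodule.eq_of_le_of_finrank_eq hle (hl'.trans hl.symm)).symm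
  have hfin : Module.finrank ℝ Plane = 2 := by simp
  have htop : l.direction ⊔ l'.direction = ⊤ := by
    refine Submodule.eq_top_of_finrank_eq (le_antisymm (Submodule.finrank_le _) ?_)
    have := Submodule.finrank_lt_finrank_of_lt hlt
    omega
  obtain ⟨x, hx⟩ := AffineSubspace.inter_nonempty_of_nonempty_of_sup_direction_eq_top
    (hne l hl) (hne l' hl') htop
  exact Set.disjoint_left.1 h hx.1 hx.2

/-! ### Heights of the regions. -/

namespace IsRegionSystem

variable {k : ℕ} {l : Fin (k + 1) → AffineSubspace ℝ Plane} {r : Fin (k + 1 + 1) → Set Plane}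

/-- The lines of a region system are level sets of a common coordinate function. -/
theorem exists_coordinates (H : IsRegionSystem l r) :
    ∃ (f g : Plane →L[ℝ] ℝ) (c : Fin (k + 1) → ℝ),
      (∀ x y, f x = f y → g x = g y → x = y) ∧ ∀ j x, x ∈ l j ↔ f x = c j := by
  obtain ⟨f, g, hfg, hf⟩ := exists_coordinates_of_finrank_eq_one _ (H.isLine 0)
  have hdir : ∀ j, (l j).direction = (l 0).direction := by
    intro j
    by_cases hj : j = 0
    · rw [hj]
    · exact direction_eq_of_disjoint_lines (H.isLine j) (H.isLine 0) (H.nonCrossing j 0 hj)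
  have hne : ∀ j, ∃ p, p ∈ l j := by
    intro j
    have : (l j : Set Plane).Nonempty := by
      rw [AffineSubspace.nonempty_iff_ne_bot]
      intro hbot
      have := H.isLine j
      rw [hbot, AffineSubspace.direction_bot, finrank_bot] at this
      exact zero_ne_one this
    exact this
  choose p hp using hne
  refine ⟨f, g, fun j => f (p j), hfg, fun j x => ?_⟩
  rw [← AffineSubspace.vsub_right_mem_direction_iff_mem (hp j), hdir, hf, vsub_eq_sub, map_sub,
    sub_eq_zero]

/-- This makes the inequalities in `between` strict. -/
theorem notMem_line (H : IsRegionSystem l r) {i : Fin (k + 1 + 1)} {p : Plane} (hp : p ∈ r i)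
    (j : Fin (k + 1)) : p ∉ l j := by
  have hi : r i ∈ range r := mem_range_self i
  rw [H.range_eq] at hi
  obtain ⟨x, -, hx⟩ := hi
  rw [hx] at hp
  exact fun hj => connectedComponentIn_subset _ _ hp (mem_iUnion.2 ⟨j, hj⟩)

/-- A segment meets a level set of a linear functional precisely when the values of the functional
at its end-points enclose the level. -/
theorem segment_inter_nonempty_iff (f : Plane →L[ℝ] ℝ) (a : ℝ) (p q : Plane) :
    (∃ x ∈ segment ℝ p q, f x = a) ↔ a ∈ uIcc (f p) (f q) := by
  rw [← segment_eq_uIcc]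
  have h := image_segment ℝ f.toLinearMap.toAffineMap p q
  simp only [LinearMap.coe_toAffineMap, ContinuousLinearMap.coe_coe] at h
  rw [← h, mem_image]

/-- The coordinate function whose level sets are the lines is monotone along the regions. -/
theorem between (H : IsRegionSystem l r) {f : Plane →L[ℝ] ℝ} {c : Fin (k + 1) → ℝ}
    (hf : ∀ j x, x ∈ l j ↔ f x = c j) {i h m : Fin (k + 1 + 1)} (hih : i < h) (hhm : h < m)
    {p q s : Plane} (hp : p ∈ r i) (hq : q ∈ r h) (hs : s ∈ r m) :
    (f p < f q ∧ f q < f s) ∨ (f s < f q ∧ f q < f p) := by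
  have cut : ∀ {i h : Fin (k + 1 + 1)}, i < h → ∀ {p q : Plane}, p ∈ r i → q ∈ r h →
      ∀ j : Fin (k + 1), c j ∈ uIcc (f p) (f q) ↔ i ≤ j.castSucc ∧ j.castSucc < h := by
    intro i h hih p q hp hq j
    rw [← H.cuts_iff i h hih p hp q hq j, ← segment_inter_nonempty_iff]
    simp only [Set.Nonempty, mem_inter_iff, SetLike.mem_coe, hf]
  have ne : ∀ {i : Fin (k + 1 + 1)} {p : Plane}, p ∈ r i → ∀ j, f p ≠ c j :=
    fun hp j hj => H.notMem_line hp j ((hf j _).2 hj)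
  have him : i < m := hih.trans hhm
  -- The line indexed by `i` separates `p` from `q` and `s`; the line indexed by `h` separates `s`
  -- from `p` and `q`. Together they force `f q` to lie between `f p` and `f s`.
  obtain ⟨a, rfl⟩ := Fin.exists_castSucc_eq.2 (him.trans_le (Fin.le_last m)).ne
  obtain ⟨b, rfl⟩ := Fin.exists_castSucc_eq.2 (hhm.trans_le (Fin.le_last m)).ne
  have h1 := (cut hih hp hq a).2 ⟨le_rfl, hih⟩
  have h2 := (cut him hp hs a).2 ⟨le_rfl, him⟩
  have h3 := (cut hhm hq hs b).2 ⟨le_rfl, hhm⟩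
  have h4 := (cut him hp hs b).2 ⟨hih.le, hhm⟩
  have h5 : ¬ c b ∈ uIcc (f p) (f q) := fun hc => lt_irrefl _ ((cut hih hp hq b).1 hc).2
  have e1 := ne hp a
  have e2 := ne hq a
  have e3 := ne hs a
  have e4 := ne hp b
  have e5 := ne hq b
  have e6 := ne hs b
  simp only [mem_uIcc] at h1 h2 h3 h4 h5
  clear cut ne hf
  generalize f p = x at *
  generalize f q = y at *
  generalize f s = z at *
  generalize c a = u at *
  generalize c b = v at *
  grind

end IsRegionSystem

/-! ### Segments and two-edge paths parametrized by height. -/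

/-- The point at height `t` of the line through `P` and `Q`, heights being measured by `f`. -/
noncomputable def pointAtHeight (f : Plane →L[ℝ] ℝ) (P Q : Plane) (t : ℝ) : Plane :=
  -- There is no clamping: outside the heights of `P` and `Q` the point runs on along the line,
  -- which keeps it continuous in `t` everywhere. If `f P = f Q`, division by zero gives the
  -- constant `P`.
  AffineMap.lineMap P Q ((t - f P) / (f Q - f P))

section pointAtHeight

variable {f : Plane →L[ℝ] ℝ} {P Q : Plane}

theorem map_pointAtHeight (h : f P < f Q) (t : ℝ) : f (pointAtHeight f P Q t) = t := by
  have : f Q - f P ≠ 0 := (sub_pos.2 h).ne'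
  simp only [pointAtHeight, AffineMap.lineMap_apply, vsub_eq_sub, vadd_eq_add, map_add, map_smul,
    map_sub, smul_eq_mul]
  field_simp
  ring

theorem pointAtHeight_left : pointAtHeight f P Q (f P) = P := by
  simp [pointAtHeight]

theorem pointAtHeight_right (h : f P < f Q) : pointAtHeight f P Q (f Q) = Q := by
  simp [pointAtHeight, div_self (sub_pos.2 h).ne']

theorem continuous_pointAtHeight : Continuous (pointAtHeight f P Q) :=
  AffineMap.lineMap_continuous.comp (by fun_prop)

theorem pointAtHeight_mem_segment (h : f P < f Q) {t : ℝ} (ht : t ∈ Icc (f P) (f Q)) :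
    pointAtHeight f P Q t ∈ segment ℝ P Q := by
  have hpos : 0 < f Q - f P := sub_pos.2 h
  rw [segment_eq_image_lineMap]
  refine ⟨_, ⟨div_nonneg (sub_nonneg.2 ht.1) hpos.le, ?_⟩, rfl⟩
  rw [div_le_one hpos]
  linarith [ht.2]

end pointAtHeight

/-- The point at height `t` of the polygonal path `A B C`. -/
noncomputable def pathPointAtHeight (f : Plane →L[ℝ] ℝ) (A B C : Plane) (t : ℝ) : Plane :=
  if t ≤ f B then pointAtHeight f A B t else pointAtHeight f B C t

section pathPointAtHeight

variable {f : Plane →L[ℝ] ℝ} {A B C : Plane}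

theorem map_pathPointAtHeight (h : f A < f B) (h' : f B < f C) (t : ℝ) :
    f (pathPointAtHeight f A B C t) = t := by
  unfold pathPointAtHeight
  split_ifs
  exacts [map_pointAtHeight h t, map_pointAtHeight h' t]

theorem pathPointAtHeight_middle (h : f A < f B) : pathPointAtHeight f A B C (f B) = B := by
  rw [pathPointAtHeight, if_pos le_rfl, pointAtHeight_right h]

theorem continuous_pathPointAtHeight (h : f A < f B) : Continuous (pathPointAtHeight f A B C) := by
  refine Continuous.if_le continuous_pointAtHeight continuous_pointAtHeight continuous_id
    continuous_const ?_
  intro t ht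
  change t = f B at ht
  rw [ht, pointAtHeight_left, pointAtHeight_right h]

theorem pathPointAtHeight_mem (h : f A < f B) (h' : f B < f C) {t : ℝ}
    (ht : t ∈ Icc (f A) (f C)) :
    pathPointAtHeight f A B C t ∈ segment ℝ A B ∪ segment ℝ B C := by
  unfold pathPointAtHeight
  split_ifs with hB
  · exact Or.inl (pointAtHeight_mem_segment h ⟨ht.1, hB⟩)
  · exact Or.inr (pointAtHeight_mem_segment h' ⟨(not_le.1 hB).le, ht.2⟩)

end pathPointAtHeight

/-! ### Left-right order of disjoint monotone curves. -/

/-- Continuous functions which agree nowhere on an interval keep their order. -/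
theorem lt_iff_lt_of_continuous_of_ne {φ ψ : ℝ → ℝ} (hφ : Continuous φ) (hψ : Continuous ψ)
    {a b : ℝ} (hab : a ≤ b) (hne : ∀ t ∈ Icc a b, φ t ≠ ψ t) : φ a < ψ a ↔ φ b < ψ b := by
  have ha : a ∈ Icc a b := left_mem_Icc.2 hab
  have hb : b ∈ Icc a b := right_mem_Icc.2 hab
  have key : ∀ {x y}, x ∈ Icc a b → y ∈ Icc a b → φ x < ψ x → φ y < ψ y := by
    intro x y hx hy hlt
    by_contra hy'
    obtain ⟨t, ht, hEq⟩ := isPreconnected_Icc.intermediate_value₂ hx hy hφ.continuousOn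
      hψ.continuousOn hlt.le (not_lt.1 hy')
    exact hne t ht hEq
  exact ⟨key ha hb, key hb ha⟩

/-- Three pairwise disjoint paths `A i, B i, C i`, monotone with respect to the height `f`, cannot
all have their middle vertex joined to a point `O` which is above each `A i` and below each `B i`,
and below the end of every path, without a crossing. -/
theorem not_disjoint_monotone_paths {f g : Plane →L[ℝ] ℝ}
    (hfg : ∀ x y, f x = f y → g x = g y → x = y) {O : Plane} {A B C : Fin 3 → Plane}
    (hAO : ∀ i, f (A i) < f O) (hOB : ∀ i, f O < f (B i)) (hBC : ∀ i j, f (B i) < f (C j))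
    (hpath : ∀ i j, i ≠ j → Disjoint (segment ℝ (A i) (B i) ∪ segment ℝ (B i) (C i))
      (segment ℝ (A j) (B j) ∪ segment ℝ (B j) (C j)))
    (hedge : ∀ i j, i ≠ j → Disjoint (segment ℝ O (B i))
      (segment ℝ (A j) (B j) ∪ segment ℝ (B j) (C j))) : False := by
  have hAB : ∀ i, f (A i) < f (B i) := fun i => (hAO i).trans (hOB i)
  let X : Fin 3 → ℝ → ℝ := fun i t => g (pathPointAtHeight f (A i) (B i) (C i) t)
  have hX : ∀ i, Continuous (X i) := fun i =>
    g.continuous.comp (continuous_pathPointAtHeight (hAB i))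
  -- Path `j` spans all heights from `O` to `B i`, since `A j` is below `O` and `C j` is above every
  -- `B i`.
  have hmem : ∀ i j, ∀ t ∈ Icc (f O) (f (B i)), pathPointAtHeight f (A j) (B j) (C j) t ∈
      segment ℝ (A j) (B j) ∪ segment ℝ (B j) (C j) := fun i j t ht =>
    pathPointAtHeight_mem (hAB j) (hBC j j) ⟨(hAO j).le.trans ht.1, ht.2.trans (hBC i j).le⟩
  have hXne : ∀ i j, i ≠ j → ∀ t ∈ Icc (f O) (f (B i)), X j t ≠ X i t := by
    intro i j hij t ht heq
    have : pathPointAtHeight f (A j) (B j) (C j) t = pathPointAtHeight f (A i) (B i) (C i) t := by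
      refine hfg _ _ ?_ heq
      rw [map_pathPointAtHeight (hAB j) (hBC j j), map_pathPointAtHeight (hAB i) (hBC i i)]
    exact disjoint_left.1 (hpath i j hij) (hmem i i t ht) (this ▸ hmem i j t ht)
  have hZne : ∀ i j, i ≠ j → ∀ t ∈ Icc (f O) (f (B i)),
      X j t ≠ g (pointAtHeight f O (B i) t) := by
    intro i j hij t ht heq
    have : pathPointAtHeight f (A j) (B j) (C j) t = pointAtHeight f O (B i) t := by
      refine hfg _ _ ?_ heq
      rw [map_pathPointAtHeight (hAB j) (hBC j j), map_pointAtHeight (hOB i)]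
    exact disjoint_left.1 (hedge i j hij) (pointAtHeight_mem_segment (hOB i) ht)
      (this ▸ hmem i j t ht)
  -- Both sides are equivalent to path `j` passing to the left of `B i` at the height of `B i`.
  have side : ∀ i j, i ≠ j → (X j (f O) < g O ↔ X j (f O) < X i (f O)) := by
    intro i j hij
    have h1 := lt_iff_lt_of_continuous_of_ne (hX j) (hX i) (hOB i).le (hXne i j hij)
    have h2 := lt_iff_lt_of_continuous_of_ne (hX j)
      (g.continuous.comp (continuous_pointAtHeight (f := f) (P := O) (Q := B i))) (hOB i).le
      (hZne i j hij)
    simp only [Function.comp_apply, pointAtHeight_left, pointAtHeight_right (hOB i)] at h2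
    have hXi : X i (f (B i)) = g (B i) := by
      simp only [X, pathPointAtHeight_middle (hAB i)]
    rw [hXi] at h1
    rw [h1, h2]
  have hne : ∀ i j, i ≠ j → X j (f O) ≠ X i (f O) := fun i j hij =>
    hXne i j hij _ (left_mem_Icc.2 (hOB i).le)
  have s01 := side 0 1 (by decide)
  have s02 := side 0 2 (by decide)
  have s10 := side 1 0 (by decide)
  have s12 := side 1 2 (by decide)
  have s20 := side 2 0 (by decide)
  have s21 := side 2 1 (by decide)
  have n01 := hne 0 1 (by decide)
  have n02 := hne 0 2 (by decide)
  have n12 := hne 1 2 (by decide)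
  generalize X 0 (f O) = x at *
  generalize X 1 (f O) = y at *
  generalize X 2 (f O) = z at *
  -- Of three distinct values, the middle one is less than the largest, hence less than `g O`, but
  -- not less than the smallest, hence not less than `g O`.
  grind

/-! ### Application to the tree. -/

/-- In a planar drawing, edges without a common end-vertex are drawn disjointly. -/
theorem LevelTree.IsPlanarDrawing.disjoint {k : ℕ} {V : Type*} {T : LevelTree k V}
    {pos : V → Plane} (h : T.IsPlanarDrawing pos) {a b c d : V} (hab : T.graph.Adj a b)
    (hcd : T.graph.Adj c d) (hac : a ≠ c) (had : a ≠ d) (hbc : b ≠ c) (hbd : b ≠ d) :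
    Disjoint (segment ℝ (pos a) (pos b)) (segment ℝ (pos c) (pos d)) := by
  rw [disjoint_left]
  intro x hx hx'
  have hne : s(a, b) ≠ s(c, d) := by
    rw [Ne, Sym2.eq_iff]
    tauto
  obtain ⟨v, ⟨hv, hv'⟩, -⟩ := h a b c d hab hcd hne ⟨hx, hx'⟩
  simp only [mem_insert_iff, mem_singleton_iff] at hv hv'
  grind

theorem mainTheorem3 : fourLevelTree.IsRegionLevelNonplanar := by
  rintro ⟨l, r, pos, H, ⟨-, hpos⟩, hplanar⟩
  obtain ⟨f, g, c, hfg, hf⟩ := H.exists_coordinates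
  have hbetween : ∀ u v w : Fin 10, fourLevelTree.level u < fourLevelTree.level v →
      fourLevelTree.level v < fourLevelTree.level w →
      (f (pos u) < f (pos v) ∧ f (pos v) < f (pos w)) ∨
        (f (pos w) < f (pos v) ∧ f (pos v) < f (pos u)) := fun u v w huv hvw =>
    H.between hf (Fin.castSucc_lt_castSucc_iff.2 huv) (Fin.castSucc_lt_castSucc_iff.2 hvw)
      (hpos u) (hpos v) (hpos w)
  let A : Fin 3 → Fin 10 := ![4, 5, 6]
  let B : Fin 3 → Fin 10 := ![1, 2, 3]
  let C : Fin 3 → Fin 10 := ![7, 8, 9]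
  have hb1 : ∀ i j, _ := fun i j => hbetween (A i) 0 (B j)
    (by revert i; decide) (by revert j; decide)
  have hb2 : ∀ i j, _ := fun i j => hbetween 0 (B i) (C j)
    (by revert i; decide) (by revert i j; decide)
  have hadjAB : ∀ i, fourLevelTree.graph.Adj (A i) (B i) :=
    show ∀ i, underlyingTree.Adj (A i) (B i) by decide
  have hadjBC : ∀ i, fourLevelTree.graph.Adj (B i) (C i) :=
    show ∀ i, underlyingTree.Adj (B i) (C i) by decide
  have hadjOB : ∀ i, fourLevelTree.graph.Adj 0 (B i) :=
    show ∀ i, underlyingTree.Adj 0 (B i) by decide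
  have hpath : ∀ i j, i ≠ j →
      Disjoint (segment ℝ (pos (A i)) (pos (B i)) ∪ segment ℝ (pos (B i)) (pos (C i)))
        (segment ℝ (pos (A j)) (pos (B j)) ∪ segment ℝ (pos (B j)) (pos (C j))) := by
    intro i j hij
    rw [disjoint_union_left, disjoint_union_right, disjoint_union_right]
    refine ⟨⟨hplanar.disjoint (hadjAB i) (hadjAB j) ?_ ?_ ?_ ?_,
      hplanar.disjoint (hadjAB i) (hadjBC j) ?_ ?_ ?_ ?_⟩,
      hplanar.disjoint (hadjBC i) (hadjAB j) ?_ ?_ ?_ ?_,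
      hplanar.disjoint (hadjBC i) (hadjBC j) ?_ ?_ ?_ ?_⟩ <;> revert i j <;> decide
  have hedge : ∀ i j, i ≠ j → Disjoint (segment ℝ (pos 0) (pos (B i)))
      (segment ℝ (pos (A j)) (pos (B j)) ∪ segment ℝ (pos (B j)) (pos (C j))) := by
    intro i j hij
    rw [disjoint_union_right]
    refine ⟨hplanar.disjoint (hadjOB i) (hadjAB j) ?_ ?_ ?_ ?_,
      hplanar.disjoint (hadjOB i) (hadjBC j) ?_ ?_ ?_ ?_⟩ <;> revert i j <;> decide
  -- `hbetween` fixes heights only up to reversal. Comparing one level-1 leaf with `v₁` determines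
  -- the orientation for all vertices; in the reversed case `-f` serves as the height.
  rcases lt_or_ge (f (pos (A 0))) (f (pos 0)) with h | h
  · have hOB : ∀ j, f (pos 0) < f (pos (B j)) := fun j => by
      rcases hb1 0 j with h' | h' <;> linarith
    refine not_disjoint_monotone_paths hfg (A := pos ∘ A) (C := pos ∘ C)
      (fun i => ?_) hOB (fun i j => ?_) hpath hedge
    · change f (pos (A i)) < f (pos 0)
      rcases hb1 i 0 with h' | h' <;> linarith [hOB 0]
    · change f (pos (B i)) < f (pos (C j))
      rcases hb2 i j with h' | h' <;> linarith [hOB i]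
  · have hOB : ∀ j, f (pos (B j)) < f (pos 0) := fun j => by
      rcases hb1 0 j with h' | h' <;> linarith
    refine not_disjoint_monotone_paths (f := -f) (g := g) (fun x y hx => hfg x y (by simpa using hx))
      (A := pos ∘ A) (C := pos ∘ C) (fun i => ?_) (fun i => neg_lt_neg (hOB i)) (fun i j => ?_)
      hpath hedge
    · change -f (pos (A i)) < -f (pos 0)
      rcases hb1 i 0 with h' | h' <;> linarith [hOB 0]
    · change -f (pos (B i)) < -f (pos (C j))
      rcases hb2 i j with h' | h' <;> linarith [hOB i]
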